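/- Let $\mathbb{Z}^2$ be the square lattice, in which $u=(u_x,u_y)$ and $v=(v_x,v_y)$ are adjacent iff $|u_x-v_x|+|u_y-v_y|=1$. In site percolation with parameter $p\in[0,1]$ every site is independently open with probability $p$ and closed otherwise. The open cluster $C_u$ of a site $u$ is the set of sites joined to $u$ by a path of open sites (endpoints included; so $C_u=\emptyset$ if $u$ is closed), its boundary $\partial C_u$ is the set of closed sites adjacent to a site of $C_u$, and $C_u^+=C_u\cup\partial C_u$ is the extended cluster of $u$. Let $\theta(p)$ be the probability that the origin lies in an infinite open cluster, $p_c=\sup\{p\in[0,1]:\theta(p)=0\}$ the critical probability, and $\theta^+(p)$ the probability that the origin lies in an infinite extended cluster. (For $p>p_c$ it is well known that the infinite extended cluster is almost surely unique.) Let $p>p_c$, let $k,n\ge 0$ be integers, and consider $n$ independent site percolations on $\mathbb{Z}^2$ with parameter $p$, defined on a probability space with measure $\mathbb{P}$. Let $C_{k,n}^+$ be the set of sites of $\mathbb{Z}^2$ that lie in an infinite extended cluster in at least $k$ of the $n$ percolations, and for odd $m$ let $\Gamma_m=\left[-\frac{m-1}{2},\frac{m-1}{2}\right]^2\cap\mathbb{Z}^2$.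 Put $$\theta_{k,n}^+(p)=\sum_{j=k}^{n}\binom nj\,(\theta^+(p))^j\,(1-\theta^+(p))^{n-j}.$$ Then $$\lim_{\substack{m\to\infty\\ m\text{ odd}}}\frac{1}{m^2}\left|C_{k,n}^+\cap\Gamma_m\right|=\theta_{k,n}^+(p)\qquad\mathbb{P}\text{-almost surely},$$ and $\theta_{k,n}^+(p)$ is the probability that the origin belongs to $C_{k,n}^+$, i.e. $\mathbb{P}(\mathbf 0\in C_{k,n}^+)=\theta_{k,n}^+(p)$. -/

import Mathlib

open MeasureTheory ProbabilityTheory Filter Topology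

namespace SitePercolation

/-- The square lattice: `u` and `v` are joined by an edge iff `|u - v| = 1` in the `ℓ¹` norm. -/
def squareLattice : SimpleGraph (ℤ × ℤ) where
  Adj u v := |u.1 - v.1| + |u.2 - v.2| = 1
  symm := ⟨fun u v h => by rw [abs_sub_comm v.1, abs_sub_comm v.2]; exact h⟩
  loopless := ⟨fun u h => by simp at h⟩

/-- A realization of one site percolation: the site `u` is open iff `ω u = true`. -/
abbrev Config : Type := ℤ × ℤ → Bool

/-- `u ⟷ v`: there is a lattice path from `u` to `v` all of whose sites, end points included,
are open. -/
def OpenConnected (ω : Config) (u v : ℤ × ℤ) : Prop :=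
  ∃ w : squareLattice.Walk u v, ∀ x ∈ w.support, ω x = true

/-- The open cluster `C_u`; it is empty when `u` is closed. -/
def openCluster (ω : Config) (u : ℤ × ℤ) : Set (ℤ × ℤ) :=
  {v | OpenConnected ω u v}

/-- The boundary `∂C_u`: the closed sites adjacent to some site of `C_u`. -/
def clusterBoundary (ω : Config) (u : ℤ × ℤ) : Set (ℤ × ℤ) :=
  {v | ω v = false ∧ ∃ w ∈ openCluster ω u, squareLattice.Adj v w}

/-- The extended cluster `C_u⁺ = C_u ∪ ∂C_u`. -/
def extendedCluster (ω : Config) (u : ℤ × ℤ) : Set (ℤ × ℤ) :=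
  openCluster ω u ∪ clusterBoundary ω u

/-- The sites that lie in an infinite open cluster. -/
def infiniteOpenCluster (ω : Config) : Set (ℤ × ℤ) :=
  {x | ∃ u, (openCluster ω u).Infinite ∧ x ∈ openCluster ω u}

/-- The sites that lie in an infinite extended cluster. -/
def infiniteExtendedCluster (ω : Config) : Set (ℤ × ℤ) :=
  {x | ∃ u, (extendedCluster ω u).Infinite ∧ x ∈ extendedCluster ω u}

/-- The law of site percolation with parameter `p`: the product over all sites of the
Bernoulli measure giving mass `p` to `true` (open) and `1 - p` to `false` (closed). -/
noncomputable def percolationMeasure (p : unitInterval) : Measure Config :=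
  Measure.infinitePi fun _ : ℤ × ℤ => bernoulliMeasure true false p

/-- The percolation probability `θ(p)`. -/
noncomputable def theta (p : unitInterval) : ℝ :=
  (percolationMeasure p).real {ω | (0, 0) ∈ infiniteOpenCluster ω}

/-- The probability `θ⁺(p)` that the origin is in an infinite extended cluster. -/
noncomputable def thetaPlus (p : unitInterval) : ℝ :=
  (percolationMeasure p).real {ω | (0, 0) ∈ infiniteExtendedCluster ω}

/-- The critical probability `p_c`. -/
noncomputable def criticalProbability : unitInterval :=
  sSup {p : unitInterval | theta p = 0}

/-- `C⁺_{k,n}`: the sites that lie in the infinite extended cluster in at least `k` of the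
`n` percolations `ω 0, …, ω (n - 1)`. -/
def extendedClusterAtLeast (k : ℕ) {n : ℕ} (ω : Fin n → Config) : Set (ℤ × ℤ) :=
  {u | k ≤ {i : Fin n | u ∈ infiniteExtendedCluster (ω i)}.ncard}

/-- `θ⁺_{k,n}(p)`. -/
noncomputable def thetaPlusAtLeast (k n : ℕ) (p : unitInterval) : ℝ :=
  ∑ j ∈ Finset.Icc k n, (n.choose j : ℝ) * thetaPlus p ^ j * (1 - thetaPlus p) ^ (n - j)

/-- The grid `Γ_m = [-(m-1)/2, (m-1)/2]² ∩ ℤ²`. -/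
def grid (m : ℕ) : Set (ℤ × ℤ) :=
  {u | 2 * |u.1| ≤ (m : ℤ) - 1 ∧ 2 * |u.2| ≤ (m : ℤ) - 1}

theorem grid_finite (m : ℕ) : (grid m).Finite := by
  refine ((Set.finite_Icc (-(m : ℤ)) m).prod (Set.finite_Icc (-(m : ℤ)) m)).subset ?_
  rintro ⟨a, b⟩ ⟨ha, hb⟩
  simp only [Set.mem_prod, Set.mem_Icc]
  have h1 := le_abs_self a
  have h2 := neg_abs_le a
  have h3 := le_abs_self b
  have h4 := neg_abs_le b
  dsimp only at ha hb
  omega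

end SitePercolation

/-! Whether $u$ belongs to $C^+_{k,n}$ is one fixed event $A$ about the i.i.d. field formed by all
$n$ percolations, evaluated after translating the field by $u$. The density is thus a spatial
average of $A$ over boxes, and its limit is the probability of $A$, which is a binomial tail because
the $n$ percolations are independent.

The pointwise ergodic theorem for boxes, `ae_tendsto_visitCount`, combines a dense class with a
maximal inequality. For an event depending on finitely many coordinates, the variance bound
`integral_sq_sum_shift_le` makes the second moments of the centred averages summable, so the
averages converge almost surely. A general event is approximated by such cylinders;
`measureReal_maximal_le`, transferred from the covering bound `mul_card_maximal_le` on the lattice,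
controls the error for all box sizes at once. -/

namespace SitePercolation

/-! ### Boxes and the weak type inequality on the lattice -/

/-- The box of side `2 r + 1` centred at `u`. -/
noncomputable def box (u : ℤ × ℤ) (r : ℕ) : Finset (ℤ × ℤ) :=
  Finset.Icc (u - ((r : ℤ), (r : ℤ))) (u + ((r : ℤ), (r : ℤ)))

theorem mem_box {u v : ℤ × ℤ} {r : ℕ} :
    v ∈ box u r ↔ (u.1 - r ≤ v.1 ∧ v.1 ≤ u.1 + r) ∧ (u.2 - r ≤ v.2 ∧ v.2 ≤ u.2 + r) := by
  simp only [box, Finset.mem_Icc, Prod.le_def, Prod.fst_sub, Prod.snd_sub, Prod.fst_add,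
    Prod.snd_add]
  tauto

theorem card_box (u : ℤ × ℤ) (r : ℕ) : (box u r).card = (2 * r + 1) ^ 2 := by
  have h : box u r = Finset.Icc (u.1 - r) (u.1 + r) ×ˢ Finset.Icc (u.2 - r) (u.2 + r) := by
    ext v
    simp only [mem_box, Finset.mem_product, Finset.mem_Icc]
  rw [h, Finset.card_product, Int.card_Icc, Int.card_Icc, sq]
  congr 1 <;> omega

theorem add_mem_box {u v : ℤ × ℤ} {r : ℕ} : u + v ∈ box u r ↔ v ∈ box 0 r := by
  simp only [mem_box, Prod.fst_add, Prod.snd_add, Prod.fst_zero, Prod.snd_zero]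
  omega

open Classical in
/-- The number of points of `D` in a box. -/
noncomputable def boxCount (D : Set (ℤ × ℤ)) (u : ℤ × ℤ) (r : ℕ) : ℕ :=
  ((box u r).filter (· ∈ D)).card

/-- The weak type inequality for the maximal function of counting measure on the lattice,
restricted to a box. -/
theorem mul_card_maximal_le (D : Set (ℤ × ℤ)) {c : ℝ} (hc : 0 ≤ c) (R K : ℕ) :
    c * boxCount {u | ∃ r ≤ K, c * (2 * r + 1) ^ 2 < boxCount D u r} 0 R ≤
      9 * boxCount D 0 (R + K) := by
  classical
  set t : Set (ℤ × ℤ) := {u | ∃ r ≤ K, c * (2 * r + 1) ^ 2 < boxCount D u r}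
  choose! ρ hρK hρ using fun (u : ℤ × ℤ) (hu : u ∈ t) => hu
  set s : Finset (ℤ × ℤ) := (box 0 R).filter (· ∈ t)
  have hst : ∀ u ∈ s, u ∈ t := fun u hu => (Finset.mem_filter.1 hu).2
  -- With ratio 2, each box meets a selected box of at least half its radius. Only the centres need
  -- covering, and $\rho_a+\rho_b\le 3\rho_b$, so tripling the selected boxes is enough.
  obtain ⟨w, hws, hdisj, hcov⟩ := Vitali.exists_disjoint_subfamily_covering_enlargement
    (fun u => (box u (ρ u) : Set (ℤ × ℤ))) (s : Set (ℤ × ℤ)) (fun u => (ρ u : ℝ)) 2 one_lt_two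
    (fun u _ => Nat.cast_nonneg _) K (fun u hu => by exact_mod_cast hρK u (hst u hu))
    (fun u _ => ⟨u, by simp [mem_box]⟩)
  lift w to Finset (ℤ × ℤ) using s.finite_toSet.subset hws
  rw [Finset.coe_subset] at hws
  have hsub : s ⊆ w.biUnion fun b => box b (3 * ρ b) := by
    intro a ha
    obtain ⟨b, hb, ⟨z, hza, hzb⟩, hab⟩ := hcov a ha
    have hab' : ρ a ≤ 2 * ρ b := by exact_mod_cast hab
    refine Finset.mem_biUnion.2 ⟨b, hb, ?_⟩
    rw [Finset.mem_coe, mem_box] at hza hzb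
    rw [mem_box]
    push_cast
    omega
  -- The constant 9 comes from $6\rho+1\le 3(2\rho+1)$, squared.
  have h1 : (s.card : ℝ) ≤ ∑ b ∈ w, 9 * (2 * (ρ b : ℝ) + 1) ^ 2 := by
    calc (s.card : ℝ) ≤ ((∑ b ∈ w, (box b (3 * ρ b)).card : ℕ) : ℝ) := by
          exact_mod_cast (Finset.card_le_card hsub).trans Finset.card_biUnion_le
      _ ≤ _ := by
          push_cast
          refine Finset.sum_le_sum fun b _ => ?_
          rw [card_box]
          push_cast
          have : (0 : ℝ) ≤ ρ b := Nat.cast_nonneg _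
          nlinarith
  have h2 : ∑ b ∈ w, boxCount D b (ρ b) ≤ boxCount D 0 (R + K) := by
    unfold boxCount
    rw [← Finset.card_biUnion]
    · refine Finset.card_le_card fun v hv => ?_
      obtain ⟨b, hb, hv⟩ := Finset.mem_biUnion.1 hv
      obtain ⟨hv, hvD⟩ := Finset.mem_filter.1 hv
      have hbR := (Finset.mem_filter.1 (hws hb)).1
      have hK := hρK b (hst b (hws hb))
      refine Finset.mem_filter.2 ⟨?_, hvD⟩
      rw [mem_box] at hv hbR ⊢
      simp only [Prod.fst_zero, Prod.snd_zero] at hbR ⊢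
      push_cast
      omega
    · intro a ha b hb hab
      exact (Finset.disjoint_coe.1 (hdisj ha hb hab)).mono (Finset.filter_subset _ _)
        (Finset.filter_subset _ _)
  have h3 : boxCount t 0 R = s.card := by
    unfold boxCount s
    congr!
  rw [h3]
  calc c * s.card ≤ c * ∑ b ∈ w, 9 * (2 * (ρ b : ℝ) + 1) ^ 2 :=
        mul_le_mul_of_nonneg_left h1 hc
    _ = 9 * ∑ b ∈ w, c * (2 * (ρ b : ℝ) + 1) ^ 2 := by
        rw [Finset.mul_sum, Finset.mul_sum]
        exact Finset.sum_congr rfl fun _ _ => by ring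
    _ ≤ 9 * ∑ b ∈ w, (boxCount D b (ρ b) : ℝ) := by
        gcongr with b hb
        exact (hρ b (hst b (hws hb))).le
    _ ≤ 9 * boxCount D 0 (R + K) := by
        gcongr
        exact_mod_cast h2

/-! ### The maximal inequality for measure-preserving actions -/

section Action

variable {E : Type*} {T : ℤ × ℤ → E → E}

/-- The number of translates of `x` by the sites of a box centred at the origin that lie in `A`. -/
noncomputable def visitCount (T : ℤ × ℤ → E → E) (A : Set E) (r : ℕ) (x : E) : ℕ :=
  boxCount {u | T u x ∈ A} 0 r

theorem boxCount_translate (hT : ∀ u v x, T u (T v x) = T (u + v) x) (A : Set E) (r : ℕ)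
    (u : ℤ × ℤ) (x : E) : boxCount {v | T v x ∈ A} u r = visitCount T A r (T u x) := by
  classical
  unfold visitCount boxCount
  symm
  refine Finset.card_bij (fun v _ => u + v) ?_ (fun a _ b _ h => add_left_cancel h) ?_
  · intro v hv
    simp only [Finset.mem_filter, Set.mem_ofPred_eq, hT] at hv ⊢
    exact ⟨add_mem_box.2 hv.1, by rw [add_comm]; exact hv.2⟩
  · intro v hv
    simp only [Finset.mem_filter, Set.mem_ofPred_eq, hT] at hv ⊢
    refine ⟨v - u, ⟨?_, by simpa using hv.2⟩, by simp⟩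
    rw [← add_mem_box (u := u), add_sub_cancel]
    exact hv.1

theorem visitCount_eq_sum (T : ℤ × ℤ → E → E) (A : Set E) (r : ℕ) (x : E) :
    (visitCount T A r x : ℝ) = ∑ u ∈ box 0 r, A.indicator 1 (T u x) := by
  classical
  unfold visitCount boxCount
  rw [Finset.card_filter]
  push_cast
  exact Finset.sum_congr rfl fun u _ => by simp [Set.indicator_apply]

variable [MeasurableSpace E] {μ : Measure E}

theorem measurable_visitCount (hT : ∀ u, Measurable (T u)) {A : Set E} (hA : MeasurableSet A)
    (r : ℕ) : Measurable fun x => (visitCount T A r x : ℝ) := by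
  simp_rw [visitCount_eq_sum]
  exact Finset.measurable_sum _ fun u _ => (measurable_one.indicator hA).comp (hT u)

theorem integrable_visitCount [IsFiniteMeasure μ] (hμ : ∀ u, MeasurePreserving (T u) μ μ)
    {A : Set E} (hA : MeasurableSet A) (r : ℕ) :
    Integrable (fun x => (visitCount T A r x : ℝ)) μ := by
  simp_rw [visitCount_eq_sum]
  exact integrable_finsetSum _ fun u _ =>
    (hμ u).integrable_comp_of_integrable ((integrable_const (1 : ℝ)).indicator hA)

theorem integral_visitCount [IsFiniteMeasure μ] (hμ : ∀ u, MeasurePreserving (T u) μ μ)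
    {A : Set E} (hA : MeasurableSet A) (r : ℕ) :
    ∫ x, (visitCount T A r x : ℝ) ∂μ = (2 * r + 1) ^ 2 * μ.real A := by
  simp_rw [visitCount_eq_sum]
  have hi : ∀ u, Integrable (fun x => A.indicator (1 : E → ℝ) (T u x)) μ := fun u =>
    (hμ u).integrable_comp_of_integrable ((integrable_const (1 : ℝ)).indicator hA)
  have hint : ∀ u, ∫ x, A.indicator (1 : E → ℝ) (T u x) ∂μ = μ.real A := fun u => by
    rw [← integral_map (hμ u).measurable.aemeasurable, (hμ u).map_eq, integral_indicator_one hA]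
    rw [(hμ u).map_eq]
    exact (measurable_one.indicator hA).aestronglyMeasurable
  rw [integral_finsetSum _ fun u _ => hi u, Finset.sum_congr rfl fun u _ => hint u,
    Finset.sum_const, card_box, nsmul_eq_mul]
  push_cast
  ring

/-- The maximal ergodic inequality for actions of `ℤ²`. -/
theorem measureReal_maximal_le [IsProbabilityMeasure μ]
    (hT : ∀ u v x, T u (T v x) = T (u + v) x) (hμ : ∀ u, MeasurePreserving (T u) μ μ)
    {D : Set E} (hD : MeasurableSet D) {c : ℝ} (hc : 0 < c) :
    μ.real {x | ∃ r : ℕ, c * (2 * r + 1) ^ 2 < visitCount T D r x} ≤ 9 * μ.real D / c := by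
  -- Radii are truncated at $K$ so that boxes centred within radius $R$ stay within radius $R+K$.
  set B : ℕ → Set E := fun K => {x | ∃ r ≤ K, c * (2 * r + 1) ^ 2 < visitCount T D r x} with hB
  have hBm : ∀ K, MeasurableSet (B K) := fun K => by
    have : B K = ⋃ r ∈ Set.Iic K, {x | c * (2 * r + 1) ^ 2 < visitCount T D r x} := by
      ext x; simp [hB]
    rw [this]
    exact MeasurableSet.biUnion (Set.to_countable _) fun r _ =>
      measurableSet_lt measurable_const (measurable_visitCount (fun u => (hμ u).measurable) hD r)
  -- Transference: the lattice inequality is applied along the orbit of each $x$ and integrated;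
  -- invariance turns each count into a box size times a measure.
  have hbound : ∀ K R : ℕ, c * ((2 * R + 1) ^ 2 * μ.real (B K)) ≤
      9 * ((2 * (R + K : ℕ) + 1) ^ 2 * μ.real D) := fun K R => by
    rw [← integral_visitCount hμ (hBm K), ← integral_visitCount hμ hD, ← integral_const_mul,
      ← integral_const_mul]
    refine integral_mono ((integrable_visitCount hμ (hBm K) R).const_mul _)
      ((integrable_visitCount hμ hD _).const_mul _) fun x => ?_
    have hset : {u | ∃ r ≤ K, c * (2 * r + 1) ^ 2 < boxCount {v | T v x ∈ D} u r} =
        {u | T u x ∈ B K} := by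
      ext u
      simp only [hB, Set.mem_ofPred_eq, boxCount_translate hT]
    have := mul_card_maximal_le {u | T u x ∈ D} hc.le R K
    rwa [hset] at this
  -- For fixed $K$, the boundary layer becomes negligible as $R\to\infty$.
  have hK : ∀ K, μ.real (B K) ≤ 9 * μ.real D / c := fun K => by
    have hlim : Tendsto (fun R : ℕ => ((2 * (R + K : ℕ) + 1 : ℝ) / (2 * R + 1)) ^ 2) atTop
        (𝓝 1) := by
      have h0 : Tendsto (fun R : ℕ => (1 + 2 * K / (2 * R + 1) : ℝ) ^ 2) atTop
          (𝓝 ((1 + 0) ^ 2)) := by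
        refine (tendsto_const_nhds.add (Tendsto.div_atTop tendsto_const_nhds ?_)).pow 2
        exact tendsto_atTop_add_const_right _ _
          (tendsto_natCast_atTop_atTop.const_mul_atTop two_pos)
      rw [add_zero, one_pow] at h0
      refine h0.congr fun R => ?_
      congr 1
      push_cast
      field_simp
      ring
    have h1 := (hlim.const_mul (9 * μ.real D / c))
    rw [mul_one] at h1
    refine ge_of_tendsto' h1 fun R => ?_
    have h2 := hbound K R
    have hpos : (0 : ℝ) < (2 * R + 1) ^ 2 := by positivity
    rw [div_pow, div_mul_div_comm, le_div_iff₀ (by positivity)]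
    linarith
  have hU : {x | ∃ r : ℕ, c * (2 * r + 1) ^ 2 < visitCount T D r x} = ⋃ K, B K := by
    ext x
    simp only [hB, Set.mem_ofPred_eq, Set.mem_iUnion]
    exact ⟨fun ⟨r, h⟩ => ⟨r, r, le_rfl, h⟩, fun ⟨_, r, _, h⟩ => ⟨r, h⟩⟩
  rw [hU]
  have hmono : Monotone B := fun K L hKL x ⟨r, hr, h⟩ => ⟨r, hr.trans hKL, h⟩
  have hcont := tendsto_measure_iUnion_atTop (μ := μ) hmono
  exact le_of_tendsto' ((ENNReal.tendsto_toReal (measure_ne_top _ _)).comp hcont) hK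

end Action

/-! ### The pointwise ergodic theorem for i.i.d. fields -/

section Shift

variable {ι S : Type*}

/-- Translation of a field of families of variables on the lattice. -/
def shift (v : ℤ × ℤ) (x : ι × (ℤ × ℤ) → S) : ι × (ℤ × ℤ) → S :=
  fun a => x (a.1, a.2 + v)

theorem shift_shift (u v : ℤ × ℤ) (x : ι × (ℤ × ℤ) → S) :
    shift u (shift v x) = shift (u + v) x := by
  ext a
  simp only [shift, add_assoc]

variable [MeasurableSpace S]

theorem measurable_shift (v : ℤ × ℤ) : Measurable (shift (ι := ι) (S := S) v) :=
  measurable_pi_lambda _ fun _ => measurable_pi_apply _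

variable (ν : Measure S) [IsProbabilityMeasure ν]

theorem measurePreserving_shift (v : ℤ × ℤ) :
    MeasurePreserving (shift v) (Measure.infinitePi fun _ : ι × (ℤ × ℤ) => ν)
      (Measure.infinitePi fun _ : ι × (ℤ × ℤ) => ν) := by
  refine ⟨measurable_shift v, ?_⟩
  refine Measure.map_infinitePi_infinitePi_of_inj (P := fun _ : ι × (ℤ × ℤ) => ν)
    (f := fun a : ι × (ℤ × ℤ) => (a.1, a.2 + v)) ?_
  rintro ⟨i, a⟩ ⟨j, b⟩ h
  simpa using h

open Classical in
theorem indepFun_shift (F : Finset (ι × (ℤ × ℤ))) {h : (F → S) → ℝ} (hh : Measurable h)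
    {u v : ℤ × ℤ} (huv : Disjoint (F.image fun a => (a.1, a.2 + u))
      (F.image fun a => (a.1, a.2 + v))) :
    IndepFun (fun x => h (F.restrict (shift u x))) (fun x => h (F.restrict (shift v x)))
      (Measure.infinitePi fun _ : ι × (ℤ × ℤ) => ν) := by
  have hind : iIndepFun (fun (a : ι × (ℤ × ℤ)) (x : ι × (ℤ × ℤ) → S) => x a)
      (Measure.infinitePi fun _ : ι × (ℤ × ℤ) => ν) :=
    iIndepFun_infinitePi (X := fun _ s => s) (fun _ => measurable_id)
  have key := hind.indepFun_finset _ _ huv fun a => measurable_pi_apply a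
  have hm : ∀ w : ℤ × ℤ, Measurable fun (y : ↥(F.image fun a => (a.1, a.2 + w)) → S) =>
      h fun a : F => y ⟨(a.1.1, a.1.2 + w), Finset.mem_image_of_mem _ a.2⟩ := fun w =>
    hh.comp (measurable_pi_lambda _ fun _ => measurable_pi_apply _)
  exact key.comp (hm u) (hm v)

/-- After expanding the square, a pair $u,v$ contributes only if the translates of $F$ by $u$ and
$v$ meet; for each $u$ there are at most $|F|^2$ such $v$. -/
theorem integral_sq_sum_shift_le (F : Finset (ι × (ℤ × ℤ))) {h : (F → S) → ℝ}
    (hh : Measurable h) (h1 : ∀ y, |h y| ≤ 1)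
    (h0 : ∫ x, h (F.restrict x) ∂(Measure.infinitePi fun _ : ι × (ℤ × ℤ) => ν) = 0)
    (s : Finset (ℤ × ℤ)) :
    ∫ x, (∑ u ∈ s, h (F.restrict (shift u x))) ^ 2
      ∂(Measure.infinitePi fun _ : ι × (ℤ × ℤ) => ν) ≤ s.card * F.card ^ 2 := by
  classical
  set μ := Measure.infinitePi fun _ : ι × (ℤ × ℤ) => ν
  have hm : ∀ u, Measurable fun x : ι × (ℤ × ℤ) → S => h (F.restrict (shift u x)) := fun u =>
    hh.comp ((Finset.measurable_restrict F).comp (measurable_shift u))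
  have hle : ∀ u v x, |h (F.restrict (shift u x)) * h (F.restrict (shift v x))| ≤ 1 :=
    fun u v x => by
      rw [abs_mul]
      exact mul_le_one₀ (h1 _) (abs_nonneg _) (h1 _)
  have hint : ∀ u v, Integrable
      (fun x => h (F.restrict (shift u x)) * h (F.restrict (shift v x))) μ := fun u v =>
    Integrable.of_bound ((hm u).mul (hm v)).aestronglyMeasurable 1
      (Eventually.of_forall fun x => hle u v x)
  have hzero : ∀ u, ∫ x, h (F.restrict (shift u x)) ∂μ = 0 := fun u => by
    have hmp : μ.map (shift u) = μ := (measurePreserving_shift ν u).map_eq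
    rw [← h0]
    conv_rhs => rw [← hmp]
    rw [integral_map (measurable_shift u).aemeasurable]
    exact (hh.comp (Finset.measurable_restrict F)).aestronglyMeasurable
  have hcov : ∀ u v, ∫ x, h (F.restrict (shift u x)) * h (F.restrict (shift v x)) ∂μ ≤
      if v ∈ (F ×ˢ F).image (fun a => u + a.1.2 - a.2.2) then 1 else 0 := fun u v => by
    split_ifs with hv
    · calc _ ≤ ∫ _, (1 : ℝ) ∂μ := integral_mono (hint u v) (integrable_const _) fun x =>
            (le_abs_self _).trans (hle u v x)
        _ = 1 := by simp
    · refine ((indepFun_shift ν F hh ?_).integral_mul_eq_mul_integral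
        (hm u).aestronglyMeasurable (hm v).aestronglyMeasurable).le.trans ?_
      · rw [Finset.disjoint_left]
        intro c hcu hcv
        obtain ⟨a, ha, rfl⟩ := Finset.mem_image.1 hcu
        obtain ⟨b, hb, hab⟩ := Finset.mem_image.1 hcv
        refine hv (Finset.mem_image.2 ⟨(a, b), Finset.mem_product.2 ⟨ha, hb⟩, ?_⟩)
        have := (Prod.ext_iff.1 hab).2
        simp only at this ⊢
        rw [add_comm u, ← this, add_sub_cancel_left]
      · rw [hzero, zero_mul]
  simp_rw [sq, Finset.sum_mul_sum]
  rw [integral_finsetSum _ fun u _ => integrable_finsetSum _ fun v _ => hint u v,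
    ← nsmul_eq_mul]
  refine Finset.sum_le_card_nsmul _ _ _ fun u _ => ?_
  rw [integral_finsetSum _ fun v _ => hint u v]
  refine (Finset.sum_le_sum fun v _ => hcov u v).trans ?_
  rw [← Finset.sum_filter, Finset.sum_const, nsmul_eq_mul, mul_one]
  calc ((s.filter _).card : ℝ) ≤ (((F ×ˢ F).image fun a => u + a.1.2 - a.2.2).card : ℝ) := by
        exact_mod_cast Finset.card_le_card fun v hv => (Finset.mem_filter.1 hv).2
    _ ≤ _ := by exact_mod_cast Finset.card_image_le.trans (Finset.card_product F F).le

/-- If the integrals of nonnegative functions are summable, the functions tend to zero almost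
everywhere. -/
theorem ae_tendsto_zero_of_summable_integral {E : Type*} [MeasurableSpace E] {μ : Measure E}
    {f : ℕ → E → ℝ} (hf : ∀ r, Integrable (f r) μ) (h0 : ∀ r x, 0 ≤ f r x) {b : ℕ → ℝ}
    (hb : Summable b) (hfb : ∀ r, ∫ x, f r x ∂μ ≤ b r) :
    ∀ᵐ x ∂μ, Tendsto (fun r => f r x) atTop (𝓝 0) := by
  have hb0 : ∀ r, 0 ≤ b r := fun r => (integral_nonneg (h0 r)).trans (hfb r)
  have hsum : ∫⁻ x, ∑' r, ENNReal.ofReal (f r x) ∂μ ≠ ⊤ := by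
    rw [lintegral_tsum fun r => (hf r).aemeasurable.ennreal_ofReal]
    refine ne_top_of_le_ne_top (hb.tsum_ofReal_ne_top) (ENNReal.tsum_le_tsum fun r => ?_)
    rw [← ofReal_integral_eq_lintegral_ofReal (hf r) (Eventually.of_forall (h0 r))]
    exact ENNReal.ofReal_le_ofReal (hfb r)
  filter_upwards [ae_lt_top' (AEMeasurable.tsum fun r =>
    (hf r).aemeasurable.ennreal_ofReal) hsum] with x hx
  have h1 := ENNReal.tendsto_atTop_zero_of_tsum_ne_top hx.ne
  have h2 := (ENNReal.tendsto_toReal ENNReal.zero_ne_top).comp h1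
  simpa [Function.comp_def, ENNReal.toReal_ofReal (h0 _ x)] using h2

theorem ae_tendsto_visitCount_cylinder {B : Set (ι × (ℤ × ℤ) → S)}
    (hB : B ∈ measurableCylinders fun _ : ι × (ℤ × ℤ) => S) :
    ∀ᵐ x ∂(Measure.infinitePi fun _ : ι × (ℤ × ℤ) => ν),
      Tendsto (fun r : ℕ => (visitCount shift B r x : ℝ) / (2 * r + 1) ^ 2) atTop
        (𝓝 ((Measure.infinitePi fun _ : ι × (ℤ × ℤ) => ν).real B)) := by
  classical
  set μ := Measure.infinitePi fun _ : ι × (ℤ × ℤ) => ν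
  have hBm := MeasurableSet.of_mem_measurableCylinders hB
  obtain ⟨F, C, hC, rfl⟩ := (mem_measurableCylinders _).1 hB
  set B : Set (ι × (ℤ × ℤ) → S) := cylinder F C
  set h : (F → S) → ℝ := fun y => C.indicator 1 y - μ.real B with hdef
  have hh : Measurable h := (measurable_one.indicator hC).sub_const _
  have hB1 : μ.real B ≤ 1 := measureReal_le_one
  have hB0 : 0 ≤ μ.real B := measureReal_nonneg
  have h1 : ∀ y, |h y| ≤ 1 := fun y => by
    simp only [hdef, Set.indicator_apply, Pi.one_apply]
    rw [abs_le]
    split_ifs <;> constructor <;> linarith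
  have hind : ∀ x : ι × (ℤ × ℤ) → S, h (F.restrict x) = B.indicator 1 x - μ.real B := fun x => by
    simp [hdef, Set.indicator_apply, B]
  have h0 : ∫ x, h (F.restrict x) ∂μ = 0 := by
    simp_rw [hind]
    rw [integral_sub (show Integrable (B.indicator 1) μ from
        (integrable_const (1 : ℝ)).indicator hBm) (integrable_const _),
      integral_indicator_one hBm]
    simp
  have hsum : ∀ (r : ℕ) x, ∑ u ∈ box 0 r, h (F.restrict (shift u x)) =
      (visitCount shift B r x : ℝ) - (2 * r + 1) ^ 2 * μ.real B := fun r x => by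
    simp_rw [hind, visitCount_eq_sum]
    rw [Finset.sum_sub_distrib, Finset.sum_const, card_box, nsmul_eq_mul]
    push_cast
    ring
  have hm : ∀ r, Measurable fun x : ι × (ℤ × ℤ) → S =>
      ((visitCount shift B r x : ℝ) / (2 * r + 1) ^ 2 - μ.real B) ^ 2 := fun r =>
    (((measurable_visitCount measurable_shift hBm r).div_const _).sub_const _).pow_const 2
  have heq : ∀ (r : ℕ) x, ((visitCount shift B r x : ℝ) / (2 * r + 1) ^ 2 - μ.real B) ^ 2 =
      (∑ u ∈ box 0 r, h (F.restrict (shift u x))) ^ 2 / (2 * r + 1) ^ 4 := fun r x => by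
    rw [hsum]
    field_simp
  have key : ∀ᵐ x ∂μ, Tendsto (fun r : ℕ =>
      ((visitCount shift B r x : ℝ) / (2 * r + 1) ^ 2 - μ.real B) ^ 2) atTop (𝓝 0) := by
    -- The variance is at most $|F|^2/(2r+1)^2$, already summable in dimension two, so no
    -- subsequence is needed.
    refine ae_tendsto_zero_of_summable_integral (b := fun r : ℕ =>
      (F.card : ℝ) ^ 2 * (1 / ((r + 1 : ℕ) : ℝ) ^ 2)) (fun r => ?_) (fun r x => sq_nonneg _) ?_
      fun r => ?_
    · refine Integrable.of_bound (hm r).aestronglyMeasurable 1 (Eventually.of_forall fun x => ?_)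
      rw [heq, Real.norm_eq_abs, abs_div, abs_of_nonneg (sq_nonneg _),
        abs_of_pos (by positivity : (0 : ℝ) < (2 * r + 1) ^ 4), div_le_one (by positivity)]
      have : |∑ u ∈ box 0 r, h (F.restrict (shift u x))| ≤ (2 * r + 1) ^ 2 := by
        refine (Finset.abs_sum_le_sum_abs _ _).trans ?_
        refine (Finset.sum_le_card_nsmul _ _ 1 fun u _ => h1 _).trans ?_
        rw [card_box, nsmul_eq_mul]
        push_cast
        linarith
      rw [← sq_abs]
      calc _ ≤ (((2 * r + 1) ^ 2 : ℝ)) ^ 2 := pow_le_pow_left₀ (abs_nonneg _) this 2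
        _ = _ := by ring
    · exact ((summable_nat_add_iff 1).2 (Real.summable_one_div_nat_pow.2 one_lt_two)).mul_left _
    · simp_rw [heq]
      rw [integral_div, div_le_iff₀ (by positivity)]
      refine (integral_sq_sum_shift_le ν F hh h1 h0 _).trans ?_
      rw [card_box]
      push_cast
      have hr : (0 : ℝ) ≤ r := Nat.cast_nonneg r
      have h3 : ((r : ℝ) + 1) ^ 2 ≤ (2 * r + 1) ^ 2 := by nlinarith
      have h4 : (1 : ℝ) ≤ 1 / ((r : ℝ) + 1) ^ 2 * (2 * r + 1) ^ 2 := by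
        rw [one_div_mul_eq_div, le_div_iff₀ (by positivity)]
        linarith
      calc (2 * (r : ℝ) + 1) ^ 2 * (F.card : ℝ) ^ 2
          ≤ (2 * (r : ℝ) + 1) ^ 2 * (F.card : ℝ) ^ 2 *
            (1 / ((r : ℝ) + 1) ^ 2 * (2 * r + 1) ^ 2) := le_mul_of_one_le_right (by positivity) h4
        _ = _ := by ring
  filter_upwards [key] with x hx
  have h2 := hx.sqrt
  simp_rw [Real.sqrt_sq_eq_abs, Real.sqrt_zero] at h2
  exact tendsto_sub_nhds_zero_iff.1 ((tendsto_zero_iff_abs_tendsto_zero _).2 h2)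

theorem abs_visitCount_sub_le {E : Type*} (T : ℤ × ℤ → E → E) (A B : Set E) (r : ℕ) (x : E) :
    |(visitCount T A r x : ℝ) - visitCount T B r x| ≤ visitCount T (symmDiff A B) r x := by
  classical
  simp_rw [visitCount_eq_sum]
  rw [← Finset.sum_sub_distrib]
  refine (Finset.abs_sum_le_sum_abs _ _).trans (Finset.sum_le_sum fun u _ => ?_)
  by_cases hA : T u x ∈ A <;> by_cases hB : T u x ∈ B <;>
    simp [Set.mem_symmDiff, hA, hB]

/-- The pointwise ergodic theorem for averages of an event over the boxes of the square lattice,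
for independent and identically distributed fields. -/
theorem ae_tendsto_visitCount {A : Set (ι × (ℤ × ℤ) → S)} (hA : MeasurableSet A) :
    ∀ᵐ x ∂(Measure.infinitePi fun _ : ι × (ℤ × ℤ) => ν),
      Tendsto (fun r : ℕ => (visitCount shift A r x : ℝ) / (2 * r + 1) ^ 2) atTop
        (𝓝 ((Measure.infinitePi fun _ : ι × (ℤ × ℤ) => ν).real A)) := by
  set μ := Measure.infinitePi fun _ : ι × (ℤ × ℤ) => ν
  have key : ∀ n : ℕ, ∀ᵐ x ∂μ, ∀ᶠ r : ℕ in atTop,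
      |(visitCount shift A r x : ℝ) / (2 * r + 1) ^ 2 - μ.real A| ≤ 3 * (1 / ((n : ℝ) + 1)) := by
    intro n
    set ε : ℝ := 1 / ((n : ℝ) + 1)
    have hε : 0 < ε := by positivity
    rw [ae_iff]
    refine le_antisymm (ENNReal.le_of_forall_pos_le_add fun t ht _ => ?_) zero_le
    rw [zero_add]
    -- The first bound keeps $\mu(A)$ and $\mu(B)$ within $\varepsilon$; the second makes the
    -- maximal estimate $9\mu(A\triangle B)/\varepsilon$ at most $t$.
    have hη : 0 < min ε (ε * t / 9) := lt_min hε (by positivity)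
    obtain ⟨B, hB, hBA⟩ := exists_measure_symmDiff_lt_of_generateFrom_isSetRing (μ := μ)
      isSetRing_measurableCylinders
      ⟨{Set.univ}, Set.countable_singleton _,
        Set.singleton_subset_iff.2 (univ_mem_measurableCylinders _), by simp⟩
      generateFrom_measurableCylinders.symm hA (ENNReal.ofReal_pos.2 hη)
    have hBm := MeasurableSet.of_mem_measurableCylinders hB
    have hD : μ.real (symmDiff A B) < min ε (ε * t / 9) := by
      rw [symmDiff_comm]
      exact (ENNReal.lt_ofReal_iff_toReal_lt (measure_ne_top _ _)).1 hBA
    have hAB : |μ.real A - μ.real B| ≤ ε :=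
      (abs_measureReal_sub_le_measureReal_symmDiff hA.nullMeasurableSet
        hBm.nullMeasurableSet).trans (hD.le.trans (min_le_left _ _))
    have hmax := measureReal_maximal_le (μ := μ) shift_shift (measurePreserving_shift ν)
      (hA.symmDiff hBm) hε
    have hcyl := ae_tendsto_visitCount_cylinder ν hB
    rw [ae_iff] at hcyl
    -- Outside the two exceptional sets, three errors of at most $\varepsilon$ add up: averages of
    -- $A$ against those of $B$, averages of $B$ against $\mu(B)$, and $\mu(B)$ against $\mu(A)$.
    have hsub : {x | ¬∀ᶠ r : ℕ in atTop,
        |(visitCount shift A r x : ℝ) / (2 * r + 1) ^ 2 - μ.real A| ≤ 3 * ε} ⊆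
        {x | ¬Tendsto (fun r : ℕ => (visitCount shift B r x : ℝ) / (2 * r + 1) ^ 2) atTop
          (𝓝 (μ.real B))} ∪
        {x | ∃ r : ℕ, ε * (2 * r + 1) ^ 2 < visitCount shift (symmDiff A B) r x} := by
      intro x hx
      by_contra hcon
      simp only [Set.mem_union, Set.mem_ofPred_eq, not_or, not_not, not_exists, not_lt] at hcon hx
      refine hx ?_
      filter_upwards [(Metric.tendsto_nhds.1 hcon.1) ε hε] with r hr
      rw [Real.dist_eq] at hr
      have h1 : |(visitCount shift A r x : ℝ) / (2 * r + 1) ^ 2 -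
          visitCount shift B r x / (2 * r + 1) ^ 2| ≤ ε := by
        rw [← sub_div, abs_div, abs_of_pos (by positivity : (0 : ℝ) < (2 * r + 1) ^ 2),
          div_le_iff₀ (by positivity)]
        exact (abs_visitCount_sub_le _ _ _ _ _).trans (hcon.2 r)
      rw [abs_le] at *
      rw [abs_lt] at hr
      constructor <;> linarith [hr.1, hr.2, hAB.1, hAB.2, h1.1, h1.2]
    refine (measure_mono hsub).trans ((measure_union_le _ _).trans ?_)
    rw [hcyl, zero_add, ← ofReal_measureReal, ← ENNReal.ofReal_coe_nnreal]
    refine ENNReal.ofReal_le_ofReal (hmax.trans ?_)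
    rw [div_le_iff₀ hε]
    linarith [hD.le.trans (min_le_right ε (ε * t / 9))]
  filter_upwards [ae_all_iff.2 key] with x hx
  rw [Metric.tendsto_atTop']
  intro ε hε
  obtain ⟨n, hn⟩ := exists_nat_one_div_lt (show 0 < ε / 3 by positivity)
  obtain ⟨N, hN⟩ := eventually_atTop.1 (hx n)
  refine ⟨N, fun r hr => ?_⟩
  rw [Real.dist_eq]
  linarith [hN r hr.le]

end Shift
-- Measurability of cluster events
instance countable_walk (u v : ℤ × ℤ) : Countable (squareLattice.Walk u v) :=
  Function.Injective.countable (f := fun w => w.support) fun _ _ h =>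
    SimpleGraph.Walk.ext_support h

theorem measurable_openConnected (u v : ℤ × ℤ) :
    Measurable fun ω : Config => OpenConnected ω u v := by
  unfold OpenConnected
  refine Measurable.exists fun w => Measurable.forall fun x => Measurable.imp measurable_const ?_
  exact measurableSet_setOfPred.1 ((measurableSet_singleton true).preimage (measurable_pi_apply x))

theorem measurable_mem_extendedCluster (u v : ℤ × ℤ) :
    Measurable fun ω : Config => v ∈ extendedCluster ω u := by
  refine Measurable.or (measurable_openConnected u v) (Measurable.and ?_ ?_)
  · exact measurableSet_setOfPred.1
      ((measurableSet_singleton false).preimage (measurable_pi_apply v))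
  · exact Measurable.exists fun w => (measurable_openConnected u w).and measurable_const

/-- Over a countable type this expresses infinitude with countable quantifiers only, hence
measurably. -/
theorem infinite_iff_forall_finset {α : Type*} {s : Set α} :
    s.Infinite ↔ ∀ F : Finset α, ∃ a, a ∉ F ∧ a ∈ s := by
  refine ⟨fun h F => ?_, fun h hs => ?_⟩
  · obtain ⟨a, ha, haF⟩ := h.exists_notMem_finset F
    exact ⟨a, haF, ha⟩
  · obtain ⟨a, ha, has⟩ := h hs.toFinset
    exact ha (hs.mem_toFinset.2 has)

theorem measurable_mem_infiniteExtendedCluster (x : ℤ × ℤ) :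
    Measurable fun ω : Config => x ∈ infiniteExtendedCluster ω := by
  refine Measurable.exists fun u => Measurable.and ?_ (measurable_mem_extendedCluster u x)
  simp_rw [infinite_iff_forall_finset]
  exact Measurable.forall fun F => Measurable.exists fun a =>
    measurable_const.and (measurable_mem_extendedCluster u a)

/-! ### Translation covariance of clusters -/

theorem squareLattice_adj_add (u v w : ℤ × ℤ) :
    squareLattice.Adj (u + w) (v + w) ↔ squareLattice.Adj u v := by
  simp [squareLattice]

theorem OpenConnected.of_translate {ω : Config} {v a b : ℤ × ℤ}
    (h : OpenConnected (fun u => ω (u + v)) a b) : OpenConnected ω (a + v) (b + v) := by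
  obtain ⟨w, hw⟩ := h
  let f : squareLattice →g squareLattice :=
    ⟨fun u => u + v, fun {a b} h => (squareLattice_adj_add a b v).2 h⟩
  refine ⟨w.map f, fun x hx => ?_⟩
  rw [SimpleGraph.Walk.support_map, List.mem_map] at hx
  obtain ⟨y, hy, rfl⟩ := hx
  exact hw y hy

theorem openConnected_translate (ω : Config) (v a b : ℤ × ℤ) :
    OpenConnected (fun u => ω (u + v)) a b ↔ OpenConnected ω (a + v) (b + v) := by
  refine ⟨OpenConnected.of_translate, fun h => ?_⟩
  have h' : OpenConnected (fun u => (fun u => ω (u + v)) (u + -v)) (a + v) (b + v) := by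
    simpa using h
  simpa using OpenConnected.of_translate (ω := fun u => ω (u + v)) h'

theorem mem_extendedCluster_translate (ω : Config) (v a b : ℤ × ℤ) :
    b ∈ extendedCluster (fun u => ω (u + v)) a ↔ b + v ∈ extendedCluster ω (a + v) := by
  refine or_congr (openConnected_translate ω v a b) (and_congr_right fun _ => ?_)
  refine ⟨fun ⟨w, hw, hbw⟩ => ⟨w + v, (openConnected_translate ω v a w).1 hw,
    (squareLattice_adj_add b w v).2 hbw⟩, fun ⟨w, hw, hbw⟩ => ⟨w - v, ?_, ?_⟩⟩
  · refine (openConnected_translate ω v a _).2 ?_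
    rwa [sub_add_cancel]
  · rw [← squareLattice_adj_add b _ v, sub_add_cancel]
    exact hbw

theorem infinite_extendedCluster_translate (ω : Config) (v a : ℤ × ℤ) :
    (extendedCluster (fun u => ω (u + v)) a).Infinite ↔
      (extendedCluster ω (a + v)).Infinite := by
  have h : extendedCluster ω (a + v) =
      Equiv.addRight v '' extendedCluster (fun u => ω (u + v)) a := by
    ext b
    rw [Equiv.image_eq_preimage_symm, Set.mem_preimage, mem_extendedCluster_translate]
    simp
  rw [h, Set.infinite_image_iff (Equiv.addRight v).injective.injOn]

theorem mem_infiniteExtendedCluster_translate (ω : Config) (v x : ℤ × ℤ) :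
    x ∈ infiniteExtendedCluster (fun u => ω (u + v)) ↔ x + v ∈ infiniteExtendedCluster ω := by
  refine ⟨fun ⟨u, hu, hx⟩ => ⟨u + v, (infinite_extendedCluster_translate ω v u).1 hu,
    (mem_extendedCluster_translate ω v u x).1 hx⟩, fun ⟨u, hu, hx⟩ => ⟨u - v, ?_, ?_⟩⟩
  · rwa [infinite_extendedCluster_translate, sub_add_cancel]
  · rwa [mem_extendedCluster_translate, sub_add_cancel]

theorem mem_extendedClusterAtLeast_shift (k : ℕ) {n : ℕ} (v : ℤ × ℤ)
    (x : Fin n × (ℤ × ℤ) → Bool) :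
    (0, 0) ∈ extendedClusterAtLeast k (fun i u => shift v x (i, u)) ↔
      v ∈ extendedClusterAtLeast k (fun i u => x (i, u)) := by
  have h : ∀ i, (0, 0) ∈ infiniteExtendedCluster (fun u => shift v x (i, u)) ↔
      v ∈ infiniteExtendedCluster (fun u => x (i, u)) := fun i => by
    have := mem_infiniteExtendedCluster_translate (fun u => x (i, u)) v (0, 0)
    rwa [show ((0, 0) : ℤ × ℤ) + v = v from zero_add v] at this
  simp only [extendedClusterAtLeast, Set.mem_ofPred_eq, h]

/-! ### The binomial probability at the origin -/

/-- The event that the origin lies in the infinite extended cluster exactly in the percolations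
with index in `t`. -/
def exactEvent {n : ℕ} (t : Finset (Fin n)) : Set (Fin n → Config) :=
  {ω | ∀ i, (0, 0) ∈ infiniteExtendedCluster (ω i) ↔ i ∈ t}

theorem setOf_mem_extendedClusterAtLeast (k n : ℕ) :
    {ω : Fin n → Config | (0, 0) ∈ extendedClusterAtLeast k ω} =
      ⋃ t ∈ Finset.univ.filter (fun t : Finset (Fin n) => k ≤ t.card), exactEvent t := by
  classical
  ext ω
  simp only [extendedClusterAtLeast, exactEvent, Set.mem_ofPred_eq, Set.mem_iUnion, exists_prop,
    Finset.mem_filter, Finset.mem_univ, true_and]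
  have hcoe : ∀ t : Finset (Fin n),
      (∀ i, (0, 0) ∈ infiniteExtendedCluster (ω i) ↔ i ∈ t) →
      {i | (0, 0) ∈ infiniteExtendedCluster (ω i)} = (t : Set (Fin n)) := fun t ht => by
    ext i
    exact ht i
  refine ⟨fun h => ⟨Finset.univ.filter fun i => (0, 0) ∈ infiniteExtendedCluster (ω i), ?_, ?_⟩,
    fun ⟨t, hk, ht⟩ => ?_⟩
  · rwa [← Set.ncard_coe_finset, ← hcoe _ (by simp)]
  · simp
  · rwa [hcoe t ht, Set.ncard_coe_finset]

theorem measurableSet_origin_mem :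
    MeasurableSet {ω : Config | (0, 0) ∈ infiniteExtendedCluster ω} :=
  measurableSet_setOfPred.2 (measurable_mem_infiniteExtendedCluster (0, 0))

theorem measurableSet_exactEvent {n : ℕ} (t : Finset (Fin n)) : MeasurableSet (exactEvent t) :=
  measurableSet_setOfPred.2 <| Measurable.forall fun i => Measurable.iff
    ((measurable_mem_infiniteExtendedCluster (0, 0)).comp (measurable_pi_apply i))
    measurable_const

theorem measurableSet_mem_extendedClusterAtLeast (k n : ℕ) :
    MeasurableSet {ω : Fin n → Config | (0, 0) ∈ extendedClusterAtLeast k ω} := by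
  rw [setOf_mem_extendedClusterAtLeast]
  exact Finset.measurableSet_biUnion _ fun t _ => measurableSet_exactEvent t

instance isProbabilityMeasure_percolationMeasure (p : unitInterval) :
    IsProbabilityMeasure (percolationMeasure p) := by
  unfold percolationMeasure
  infer_instance

theorem measureReal_exactEvent (p : unitInterval) {n : ℕ} (t : Finset (Fin n)) :
    (Measure.infinitePi fun _ : Fin n => percolationMeasure p).real (exactEvent t) =
      thetaPlus p ^ t.card * (1 - thetaPlus p) ^ (n - t.card) := by
  classical
  set I : Set Config := {ω | (0, 0) ∈ infiniteExtendedCluster ω}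
  have h : exactEvent t = Set.univ.pi fun i => if i ∈ t then I else Iᶜ := by
    ext ω
    simp only [exactEvent, Set.mem_ofPred_eq, Set.mem_univ_pi]
    refine forall_congr' fun i => ?_
    by_cases hi : i ∈ t <;> simp [hi, I]
  have hI : ∀ i : Fin n, (percolationMeasure p).real (if i ∈ t then I else Iᶜ) =
      if i ∈ t then thetaPlus p else 1 - thetaPlus p := fun i => by
    split_ifs
    · rfl
    · rw [probReal_compl_eq_one_sub measurableSet_origin_mem]
      rfl
  rw [Measure.infinitePi_eq_pi, h, measureReal_def, Measure.pi_pi, ENNReal.toReal_prod]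
  simp_rw [← measureReal_def, hI]
  rw [Finset.prod_ite, Finset.prod_const, Finset.prod_const, Finset.filter_not,
    Finset.filter_univ_mem, ← Finset.compl_eq_univ_sdiff, Finset.card_compl, Fintype.card_fin]

theorem measureReal_mem_extendedClusterAtLeast (p : unitInterval) (k n : ℕ) :
    (Measure.infinitePi fun _ : Fin n => percolationMeasure p).real
      {ω | (0, 0) ∈ extendedClusterAtLeast k ω} = thetaPlusAtLeast k n p := by
  classical
  rw [setOf_mem_extendedClusterAtLeast, measureReal_biUnion_finset]
  · simp_rw [measureReal_exactEvent]
    -- The summand depends on the index set only through its size, so grouping by size produces the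
    -- binomial coefficients.
    rw [Finset.sum_filter, ← Finset.powerset_univ, Finset.sum_powerset_apply_card
      (fun j => if k ≤ j then thetaPlus p ^ j * (1 - thetaPlus p) ^ (n - j) else 0),
      Finset.card_univ, Fintype.card_fin]
    simp_rw [smul_ite, smul_zero]
    rw [← Finset.sum_filter, thetaPlusAtLeast]
    refine Finset.sum_congr ?_ fun j _ => by rw [nsmul_eq_mul, mul_assoc]
    ext j
    simp only [Finset.mem_filter, Finset.mem_range, Finset.mem_Icc]
    omega
  · intro s _ t _ hst
    refine Set.disjoint_left.2 fun ω hs ht => hst (Finset.ext fun i => ?_)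
    exact (hs i).symm.trans (ht i)
  · exact fun t _ => measurableSet_exactEvent t

/-! ### Passage to the grids and conclusion -/

theorem box_eq_grid (r : ℕ) : (box 0 r : Set (ℤ × ℤ)) = grid (2 * r + 1) := by
  ext u
  simp only [Finset.mem_coe, mem_box, grid, Set.mem_ofPred_eq, Prod.fst_zero, Prod.snd_zero]
  push_cast
  rw [add_sub_cancel_right, mul_le_mul_iff_right₀ two_pos, mul_le_mul_iff_right₀ two_pos, abs_le,
    abs_le]
  omega

theorem ncard_inter_grid (D : Set (ℤ × ℤ)) (r : ℕ) :
    (D ∩ grid (2 * r + 1)).ncard = boxCount D 0 r := by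
  classical
  rw [← box_eq_grid, boxCount, ← Set.ncard_coe_finset]
  congr 1
  ext u
  simp [and_comm]

end SitePercolation

open SitePercolation in
theorem mainTheorem7 {Ω : Type*} [MeasurableSpace Ω] (P : Measure Ω) [IsProbabilityMeasure P]
    (p : unitInterval) (hp : SitePercolation.criticalProbability < p)
    (k n : ℕ)
    (X : Fin n → ℤ × ℤ → Ω → Bool)
    (hlaw : ∀ i u, HasLaw (X i u) (bernoulliMeasure true false p) P)
    (hindep : iIndepFun (fun a : Fin n × (ℤ × ℤ) => X a.1 a.2) P) :
    (∀ᵐ ω ∂P, Tendsto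
      (fun m : ℕ =>
        ((SitePercolation.extendedClusterAtLeast k (fun i u => X i u ω) ∩
          SitePercolation.grid m).ncard : ℝ) / (m : ℝ) ^ 2)
      (atTop ⊓ 𝓟 {m : ℕ | Odd m})
      (𝓝 (SitePercolation.thetaPlusAtLeast k n p))) ∧
    P.real {ω | (0, 0) ∈ SitePercolation.extendedClusterAtLeast k (fun i u => X i u ω)} =
      SitePercolation.thetaPlusAtLeast k n p := by
  set μ := Measure.infinitePi fun _ : Fin n × (ℤ × ℤ) => bernoulliMeasure true false p
  -- Joint independence over percolations and sites identifies the law of the whole field, so almost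
  -- sure statements pass from the product space to $P$.
  have hX : HasLaw (fun ω (a : Fin n × (ℤ × ℤ)) => X a.1 a.2 ω) μ P :=
    hindep.hasLaw_infinitePi (fun a => hlaw a.1 a.2)
      (aemeasurable_pi_iff.2 fun a => (hlaw a.1 a.2).aemeasurable)
  set A : Set (Fin n × (ℤ × ℤ) → Bool) :=
    {x | (0, 0) ∈ extendedClusterAtLeast k (fun i u => x (i, u))} with hAdef
  have hAm : MeasurableSet A :=
    (measurableSet_mem_extendedClusterAtLeast k n).preimage
      (MeasurableEquiv.curry (Fin n) (ℤ × ℤ) Bool).measurable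
  have hA : μ.real A = thetaPlusAtLeast k n p := by
    rw [← measureReal_mem_extendedClusterAtLeast]
    have hcurry : μ.map (MeasurableEquiv.curry (Fin n) (ℤ × ℤ) Bool) =
        Measure.infinitePi fun _ : Fin n => percolationMeasure p :=
      Measure.infinitePi_map_curry fun _ _ => bernoulliMeasure true false p
    rw [← hcurry, map_measureReal_apply (MeasurableEquiv.measurable _)
      (measurableSet_mem_extendedClusterAtLeast k n)]
    rfl
  refine ⟨?_, (hX.measureReal_eq hAm).trans hA⟩
  have herg := ae_tendsto_visitCount (ι := Fin n) (bernoulliMeasure true false p) hAm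
  have herg' : ∀ᵐ x ∂(P.map fun ω (a : Fin n × (ℤ × ℤ)) => X a.1 a.2 ω),
      Tendsto (fun r : ℕ => (visitCount shift A r x : ℝ) / (2 * r + 1) ^ 2) atTop
        (𝓝 (μ.real A)) := by
    rw [hX.map_eq]
    exact herg
  filter_upwards [ae_of_ae_map hX.aemeasurable herg'] with ω hω
  rw [hA] at hω
  -- Natural division recovers the radius: $m=2r+1$ gives $m/2=r$.
  have hhalf : Tendsto (fun m : ℕ => m / 2) (atTop ⊓ 𝓟 {m : ℕ | Odd m}) atTop :=
    (Nat.tendsto_div_const_atTop two_ne_zero).mono_left inf_le_left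
  refine (hω.comp hhalf).congr' ?_
  filter_upwards [mem_inf_of_right (mem_principal_self _)] with m hm
  obtain ⟨r, rfl⟩ := hm
  have hr : (2 * r + 1) / 2 = r := by omega
  have hset : {u | shift u (fun a : Fin n × (ℤ × ℤ) => X a.1 a.2 ω) ∈ A} =
      extendedClusterAtLeast k (fun i u => X i u ω) := by
    ext u
    rw [Set.mem_ofPred_eq, hAdef, Set.mem_ofPred_eq]
    exact mem_extendedClusterAtLeast_shift k u fun a => X a.1 a.2 ω
  have hcount : visitCount shift A r (fun a : Fin n × (ℤ × ℤ) => X a.1 a.2 ω) =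
      (extendedClusterAtLeast k (fun i u => X i u ω) ∩ grid (2 * r + 1)).ncard := by
    rw [ncard_inter_grid, ← hset, visitCount]
  simp only [Function.comp_apply, hr, hcount, Nat.cast_add, Nat.cast_mul, Nat.cast_ofNat,
    Nat.cast_one]
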